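/- Let $\mathbb D\subset\mathbb C$ be an open disc centred at $o$, let $\widetilde X$ be a complex manifold, and let $G:\widetilde X\to\mathbb C\times\mathbb D$ be a holomorphic map. For $s\in\mathbb D$ put $\widetilde X_s=(\pi_{\mathbb D}\circ G)^{-1}(s)$ and $g_s=\pi_{\mathbb C}\circ G|_{\widetilde X_s}:\widetilde X_s\to\mathbb C$. Let $G$ be a deformation of $g:X\to\mathbb C$, that is, $(X,g)$ is identified with $(\widetilde X_o,g_o)$. Let $\mathrm{Disc}(G)\subset\mathbb C\times\mathbb D$ be the set of critical values of $G$ (so that $G$ is a submersion over its complement), and suppose that $G$ is proper over the complement of $\mathrm{Disc}(G)$. Let $\eta:\mathbb D\to\mathbb C$ be a smooth function with $\eta(o)=0$ and graph $\Gamma(\eta)=\{(\eta(s),s): s\in\mathbb D\}$, and suppose that near $(0,o)$ the discriminant locus is this graph: there is an open neighbourhood $W\subseteq\mathbb C\times\mathbb C$ of $(0,o)$ with $\mathrm{Disc}(G)\cap W=\Gamma(\eta)\cap W$. Then the deformation is isomonodromic around $0$, in the following sense. Let $\mathbb D_W$ be the connected component containing $o$ of the open set $\{s\in\mathbb D:(\eta(s),s)\in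 W\}$ (so $\mathbb D_W=\mathbb D$ if $\Gamma(\eta)\subset W$, and $\mathbb D_W$ is always a neighbourhood of $o$). Let $s\in\mathbb D_W$, and let $r_0,r>0$ be such that $W$ contains $\{(z,o):|z|\le r_0\}$ and $\{(z,s):|z-\eta(s)|\le r\}$. Then parallel transport of the fibres of $g$ once counterclockwise along the circle $|z|=r_0$ from $r_0$ to $r_0$, and of the fibres of $g_s$ once counterclockwise along the circle $|z-\eta(s)|=r$ from $\eta(s)+r$ to itself, exists, where a parallel transport is the end value of a topological trivialization over $[0,1]$ of the pulled back family of fibres that starts at the identity. Moreover there is a homeomorphism $h:g^{-1}(r_0)\to g_s^{-1}(\eta(s)+r)$ such that for all monodromy homeomorphisms $\varphi_0$ of $g^{-1}(r_0)$ and $\varphi_s$ of $g_s^{-1}(\eta(s)+r)$ obtained in this way, $h\circ\varphi_0$ is isotopic to $\varphi_s\circ h$, and $\varphi_0^*\circ h^*=h^*\circ\varphi_s^*$ on singular cohomology $H^n(\,\cdot\,;A)$ for every $n\ge 0$ and every abelian group $A$. In particular the monodromy around $\eta(s)$ is independent of $s\in\mathbb D_W$ up to conjugation. -/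

import Mathlib

open CategoryTheory
open scoped Manifold ContDiff Topology unitInterval

universe u

namespace Isomonodromy

/-- The discriminant locus of a map `G` from a complex manifold to `ℂ × ℂ`: the set of its critical
values, that is, of the values taken at points where `G` is not a submersion. By definition `G` is
smooth (a submersion) over the complement of this set. -/
def discriminant {E : Type*} [NormedAddCommGroup E] [NormedSpace ℂ E]
    {Y : Type*} [TopologicalSpace Y] [ChartedSpace E Y] (G : Y → ℂ × ℂ) : Set (ℂ × ℂ) :=
  G '' {y | ¬ Function.Surjective (mfderiv 𝓘(ℂ, E) 𝓘(ℂ, ℂ × ℂ) G y)}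

/-- For `G : Y → ℂ × ℂ`, the member over `s` of the family: the restriction of the first component
of `G` to the fibre over `s` of the second component. -/
def member {Y : Type*} (G : Y → ℂ × ℂ) (s : ℂ) : {y : Y // (G y).2 = s} → ℂ :=
  fun y => (G y.1).1

/-- `G : Y → ℂ × D` is a deformation of `g : X → ℂ` over the open disc `D` of centre `o` and
radius `R`: `G` takes its values in `ℂ × D` and its restriction over `ℂ × {o}` is `g`. The space `X`
is identified with the analytic fibre (which may be singular), so that `g` is holomorphic as the
restriction of a holomorphic map; only the topology of the identification is recorded. -/
def IsDeformation {X Y : Type*} [TopologicalSpace X] [TopologicalSpace Y]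
    (g : X → ℂ) (G : Y → ℂ × ℂ) (o : ℂ) (R : ℝ) : Prop :=
  (∀ y, (G y).2 ∈ Metric.ball o R) ∧
    ∃ e : X ≃ₜ {y : Y // (G y).2 = o}, ∀ x, member G o (e x) = g x

/-- The graph of `η`, over the open disc of centre `o` and radius `R`, as a subset of `ℂ × D`. -/
def graphOver (η : ℂ → ℂ) (o : ℂ) (R : ℝ) : Set (ℂ × ℂ) :=
  {p | p.2 ∈ Metric.ball o R ∧ p.1 = η p.2}

/-- `φ` is a parallel transport of the fibres of `p` along the path `γ`: it is the end value of
a trivialization over the unit interval of the pullback of `p` along `γ`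
that starts at the identity of the fibre over the initial point of `γ`. -/
def IsTransport {E B : Type*} [TopologicalSpace E] [TopologicalSpace B] (p : E → B) {a b : B}
    (γ : Path a b) (φ : (p ⁻¹' {a} : Set E) ≃ₜ (p ⁻¹' {b} : Set E)) : Prop :=
  ∃ Φ : (I × (p ⁻¹' {a} : Set E)) ≃ₜ {q : I × E // p q.2 = γ q.1},
    (∀ q, (Φ q).1.1 = q.1) ∧ (∀ x, (Φ (0, x)).1.2 = x) ∧ ∀ x, (Φ (1, x)).1.2 = φ x

/-- The circle of centre `c` and radius `r` run through once counterclockwise,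
as a loop based at `c + r`. -/
noncomputable def circleLoop (c : ℂ) (r : ℝ) : Path (c + r) (c + r) where
  toFun t := circleMap c r (2 * Real.pi * t)
  continuous_toFun := by fun_prop
  source' := by simp [circleMap]
  target' := by simp [circleMap, Complex.exp_two_pi_mul_I]

/-- The fibre of `f` over the base point of the loop `circleLoop c r`. -/
abbrev BaseFibre {X : Type*} (f : X → ℂ) (c : ℂ) (r : ℝ) : Type _ :=
  (f ⁻¹' {c + (r : ℂ)} : Set X)

/-- `φ` is a geometric monodromy of `f` around `c`, along the circle of radius `r`. -/
def IsMonodromy {X : Type*} [TopologicalSpace X] (f : X → ℂ) (c : ℂ) (r : ℝ)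
    (φ : BaseFibre f c r ≃ₜ BaseFibre f c r) : Prop :=
  IsTransport f (circleLoop c r) φ

/-- Two homeomorphisms are isotopic. -/
def Isotopic {X Y : Type*} [TopologicalSpace X] [TopologicalSpace Y] (φ ψ : X ≃ₜ Y) : Prop :=
  ∃ H : I → (X ≃ₜ Y), Continuous (fun q : I × X => H q.1 q.2) ∧
    Continuous (fun q : I × Y => (H q.1).symm q.2) ∧ H 0 = φ ∧ H 1 = ψ

/-- The `n`-th singular cohomology functor with coefficients in the abelian group `A`: the
cohomology of the complex of homomorphisms from the integral singular chain complex to `A`. -/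
noncomputable def singularCohomology (A : AddCommGrpCat.{u}) (n : ℕ) :
    TopCat.{u}ᵒᵖ ⥤ AddCommGrpCat.{u} :=
  ((AlgebraicTopology.singularChainComplexFunctor AddCommGrpCat.{u}).obj
      (AddCommGrpCat.of (ULift.{u} ℤ))).op ⋙
    HomologicalComplex.opFunctor _ _ ⋙
    (preadditiveYoneda.obj A).mapHomologicalComplex _ ⋙
    HomologicalComplex.homologyFunctor _ _ n

/-- The homomorphism `φ^* : Hⁿ(Y; A) → Hⁿ(X; A)` that a homeomorphism `φ : X ≃ₜ Y` induces. -/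
noncomputable def cohomologyMap {X Y : Type u} [TopologicalSpace X] [TopologicalSpace Y]
    (A : AddCommGrpCat.{u}) (n : ℕ) (φ : X ≃ₜ Y) :
    (singularCohomology A n).obj (.op (TopCat.of Y)) ⟶
      (singularCohomology A n).obj (.op (TopCat.of X)) :=
  (singularCohomology A n).map (TopCat.ofHom (φ : C(X, Y))).op

/-- The monodromy of `f` around `c` (along the circle of radius `r`) and the monodromy of `f'`
around `c'` (along the circle of radius `r'`) exist and are conjugate: some homeomorphism of the
fibres conjugates one into the other up to isotopy, and its action on singular cohomology, in all
degrees and with all coefficients, conjugates the actions of the monodromies. -/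
def ConjugateMonodromy {X X' : Type u} [TopologicalSpace X] [TopologicalSpace X']
    (f : X → ℂ) (c : ℂ) (r : ℝ) (f' : X' → ℂ) (c' : ℂ) (r' : ℝ) : Prop :=
  (∃ φ, IsMonodromy f c r φ) ∧ (∃ φ', IsMonodromy f' c' r' φ') ∧
    ∃ h : BaseFibre f c r ≃ₜ BaseFibre f' c' r',
      ∀ φ φ', IsMonodromy f c r φ → IsMonodromy f' c' r' φ' →
        Isotopic (φ.trans h) (h.trans φ') ∧
        ∀ (A : AddCommGrpCat.{u}) (n : ℕ),
          cohomologyMap A n φ' ≫ cohomologyMap A n h = cohomologyMap A n h ≫ cohomologyMap A n φ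

end Isomonodromy

/-!
The theorem follows from a topological form of Ehresmann's fibration theorem. Off the graph of `η`
the part of `W` over the disc consists of regular values of `G`, over which `G` is proper. The
circle of radius `r₀` in the slice over `o` and the circle of radius `r` in the slice over `s` are
joined by a free homotopy of loops in this open set: shrink the first circle, move its centre along
the graph of `η`, and enlarge it again (`joinedIn_circlesIn`). The pullback of `G` along this
homotopy, a family over a square, is trivial (`HasShortTransport.nonempty_triv`), and a
trivialization over the square shows the monodromies of two opposite sides to be conjugate, the
other two sides being the same path (`conjugateMonodromy_of_triv`). That any two parallel transports
along the same path are isotopic needs no hypothesis on `G` (`IsTransport.isotopic`), and isotopic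
homeomorphisms agree on cohomology by homotopy invariance of singular chains.

Triviality over the square comes from uniform parallel transport over short distances: for
`c` and `c'` close to each other in a compact set of regular values, depending continuously on
parameters, the family of fibres over `c` is homeomorphic to the family over `c'`
(`hasShortTransport_of_compact`). No vector field is integrated. Instead, for a function `θ` on the
total space with values in `[0, 1]`, consider the level set `G y = c + θ y • (c' - c)`. It is the
fibre over `c` for `θ = 0` and the fibre over `c'` for `θ = 1`. If `θ` changes only inside a
submersion chart, then the old and the new level set correspond to each other by moving points
along the slices of the chart transverse to the fibres of `G`: as `c' - c` is small, each such slice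
meets each of the two level sets in exactly one point, given by the fixed point of a contraction
of `[0, 1]` (`SlideData.nonempty_fibHomeo`). A smooth partition of unity raises `θ` from `0`
to `1` in finitely many such changes (`hasShortTransport_of_slides`).
-/

namespace Isomonodromy

/-! ### Families over a space and the fragmentation step -/

/-- A homeomorphism between the families `P` and `P'` of spaces over `A`, covering the identity
of `A`. -/
structure FibHomeo {A X X' : Type*} [TopologicalSpace A] [TopologicalSpace X]
    [TopologicalSpace X'] (P : Set (A × X)) (P' : Set (A × X')) where
  /-- The underlying homeomorphism of total spaces. -/
  homeo : P ≃ₜ P'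
  fst_homeo : ∀ q, (homeo q).1.1 = q.1.1

namespace FibHomeo

variable {A X X' X'' : Type*} [TopologicalSpace A] [TopologicalSpace X] [TopologicalSpace X']
  [TopologicalSpace X'']
  {P : Set (A × X)} {P' : Set (A × X')} {P'' : Set (A × X'')}

/-- The composition. -/
def trans (Φ : FibHomeo P P') (Ψ : FibHomeo P' P'') : FibHomeo P P'' :=
  ⟨Φ.homeo.trans Ψ.homeo, fun q => by simp [Φ.fst_homeo, Ψ.fst_homeo]⟩

/-- Equal families are homeomorphic. -/
def ofEq {P₁ P₂ : Set (A × X)} (h : P₁ = P₂) : FibHomeo P₁ P₂ :=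
  ⟨Homeomorph.setCongr h, fun _ => rfl⟩

/-- Two mutually inverse maps, continuous on the families, give a homeomorphism. -/
lemma nonempty_of_maps (f : A × X → X') (g : A × X' → X)
    (hf : ContinuousOn f P) (hg : ContinuousOn g P')
    (hfP : ∀ q ∈ P, (q.1, f q) ∈ P') (hgP : ∀ q ∈ P', (q.1, g q) ∈ P)
    (hgf : ∀ q ∈ P, g (q.1, f q) = q.2) (hfg : ∀ q ∈ P', f (q.1, g q) = q.2) :
    Nonempty (FibHomeo P P') :=
  ⟨⟨{ toFun q := ⟨(q.1.1, f q.1), hfP _ q.2⟩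
      invFun q := ⟨(q.1.1, g q.1), hgP _ q.2⟩
      left_inv q := Subtype.ext (Prod.ext rfl (hgf _ q.2))
      right_inv q := Subtype.ext (Prod.ext rfl (hfg _ q.2))
      continuous_toFun := by
        have := continuousOn_iff_continuous_domRestrict.1 hf
        exact Continuous.subtype_mk ((continuous_fst.comp continuous_subtype_val).prodMk this) _
      continuous_invFun := by
        have := continuousOn_iff_continuous_domRestrict.1 hg
        exact Continuous.subtype_mk ((continuous_fst.comp continuous_subtype_val).prodMk this) _ },
    fun _ => rfl⟩⟩

end FibHomeo

section Slide

variable {Y B Z : Type*} [TopologicalSpace Y] [NormedAddCommGroup B] [NormedSpace ℝ B]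
  [TopologicalSpace Z]

/-- A horizontal structure for `p` on `V`, over `U ⊆ B`: the set `V` is
filled by slices that `p` maps bijectively to `U`, and `sl u y` is the point over `u` of the slice
through `y`. In a chart of `V` with values in `U × F` whose first coordinate is `p`, the slices are
the sets of points with a given second coordinate. -/
structure IsSlide (p : Y → B) (V : Set Y) (U : Set B) (sl : B → Y → Y) : Prop where
  apply_mem : ∀ y ∈ V, p y ∈ U
  mem : ∀ y ∈ V, ∀ u ∈ U, sl u y ∈ V
  apply_slide : ∀ y ∈ V, ∀ u ∈ U, p (sl u y) = u
  self : ∀ y ∈ V, sl (p y) y = y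
  slide_slide : ∀ y ∈ V, ∀ u ∈ U, ∀ v ∈ U, sl u (sl v y) = sl u y
  cont : ContinuousOn (fun q : B × Y => sl q.1 q.2) (U ×ˢ V)

/-- The family over `Z` of the level sets `p y = c z + θ y • d z`. -/
def level (p : Y → B) (c d : Z → B) (θ : Y → ℝ) : Set (Z × Y) :=
  {q | p q.2 = c q.1 + θ q.2 • d q.1}

variable {p : Y → B} {V V₀ S : Set Y} {U : Set B} {sl : B → Y → Y} {c d : Z → B}
  {θ θ' : Y → ℝ} {ε : ℝ}

/-- A horizontal slice contains a point of the level set `p y = c + θ y • d`, given by a fixed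
point of a self-map of the unit interval. -/
lemma exists_height (hsl : IsSlide p V U sl) (hθc : Continuous θ) (hθ : ∀ y, θ y ∈ Set.Icc 0 1)
    {y : Y} {c d : B} (hy : y ∈ V) (hd : ‖d‖ ≤ ε) (hU : Metric.closedBall c ε ⊆ U) :
    ∃ τ ∈ Set.Icc (0 : ℝ) 1, θ (sl (c + τ • d) y) = τ := by
  have hmem : ∀ τ ∈ Set.Icc (0 : ℝ) 1, c + τ • d ∈ U := fun τ hτ => hU (by
    rw [Metric.mem_closedBall, dist_self_add_left, norm_smul, Real.norm_of_nonneg hτ.1]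
    exact (mul_le_of_le_one_left (norm_nonneg _) hτ.2).trans hd)
  have hc : ContinuousOn (fun τ : ℝ => θ (sl (c + τ • d) y)) (Set.Icc 0 1) :=
    hθc.comp_continuousOn (hsl.cont.comp (f := fun τ : ℝ => (c + τ • d, y))
      (by fun_prop) fun τ hτ => ⟨hmem τ hτ, hy⟩)
  obtain ⟨τ, hτ, h⟩ := exists_mem_Icc_isFixedPt_of_mapsTo hc zero_le_one fun τ _ => hθ _
  exact ⟨τ, hτ, h⟩

/-- The fixed point of a contraction depends continuously on the contraction. -/
lemma height_dist_le {f g : ℝ → ℝ} {τ τ' : ℝ} (hτ : f τ = τ) (hτ' : g τ' = τ')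
    (hg : |g τ - g τ'| ≤ 1 / 2 * |τ - τ'|) : |τ - τ'| ≤ 2 * |f τ - g τ| := by
  have : |f τ - g τ'| ≤ |f τ - g τ| + |g τ - g τ'| := abs_sub_le _ _ _
  rw [hτ'] at this hg
  rw [hτ] at this ⊢
  linarith

open Classical in
/-- Move a point of `V₀` along its horizontal slice to the level set `p y = c z + θ y • d z`, and
leave the other points where they are. The height `τ` in the unit interval is chosen; it is unique
in the situation of `SlideData.height_unique`. -/
noncomputable def slideTo (V₀ : Set Y) (sl : B → Y → Y) (c d : Z → B) (θ : Y → ℝ)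
    (q : Z × Y) : Y :=
  if h : q.2 ∈ V₀ ∧ ∃ τ ∈ Set.Icc (0 : ℝ) 1, θ (sl (c q.1 + τ • d q.1) q.2) = τ then
    sl (c q.1 + h.2.choose • d q.1) q.2 else q.2

/-- What the fragmentation step needs of the base and the charts: a horizontal structure on `V`, an
open set `V₀ ⊆ V` whose points can move horizontally by `2 * ε`, and a displacement `d` of norm at
most `ε`. -/
structure SlideData (p : Y → B) (V V₀ : Set Y) (U : Set B) (sl : B → Y → Y) (c d : Z → B)
    (ε : ℝ) : Prop where
  slide : IsSlide p V U sl
  isOpen : IsOpen V₀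
  subset : V₀ ⊆ V
  closedBall_subset : ∀ y ∈ V₀, Metric.closedBall (p y) (2 * ε) ⊆ U
  cont_c : Continuous c
  cont_d : Continuous d
  norm_d : ∀ z, ‖d z‖ ≤ ε

/-- The function `θ` has values in the unit interval and is Lipschitz along the horizontal slices
with constant `ε⁻¹ / 2`. -/
structure IsSlow (V : Set Y) (U : Set B) (sl : B → Y → Y) (ε : ℝ) (θ : Y → ℝ) : Prop where
  cont : Continuous θ
  mem : ∀ y, θ y ∈ Set.Icc (0 : ℝ) 1
  lip : ∀ y ∈ V, ∀ u ∈ U, ∀ v ∈ U, ε * |θ (sl u y) - θ (sl v y)| ≤ 1 / 2 * dist u v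

lemma SlideData.closedBall_subset' (D : SlideData p V V₀ U sl c d ε) (hθ : ∀ y, θ y ∈ Set.Icc 0 1)
    {q : Z × Y} (hq : q ∈ level p c d θ) (hqV : q.2 ∈ V₀) :
    Metric.closedBall (c q.1) ε ⊆ U := by
  refine (Metric.closedBall_subset_closedBall' ?_).trans (D.closedBall_subset _ hqV)
  have : dist (c q.1) (p q.2) ≤ ε := by
    rw [hq, dist_self_add_right, norm_smul, Real.norm_of_nonneg (hθ _).1]
    exact (mul_le_of_le_one_left (norm_nonneg _) (hθ _).2).trans (D.norm_d _)
  linarith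

lemma SlideData.add_mem (D : SlideData p V V₀ U sl c d ε) (hθ : ∀ y, θ y ∈ Set.Icc 0 1)
    {q : Z × Y} (hq : q ∈ level p c d θ) (hqV : q.2 ∈ V₀) {τ : ℝ} (hτ : τ ∈ Set.Icc (0 : ℝ) 1) :
    c q.1 + τ • d q.1 ∈ U := D.closedBall_subset' hθ hq hqV (by
  rw [Metric.mem_closedBall, dist_self_add_left, norm_smul, Real.norm_of_nonneg hτ.1]
  exact (mul_le_of_le_one_left (norm_nonneg _) hτ.2).trans (D.norm_d _))

lemma SlideData.lip (D : SlideData p V V₀ U sl c d ε) (hε : 0 < ε) (hθ : IsSlow V U sl ε θ)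
    {z : Z} {y : Y} (hy : y ∈ V) {τ τ' : ℝ} (hτ : c z + τ • d z ∈ U) (hτ' : c z + τ' • d z ∈ U) :
    |θ (sl (c z + τ • d z) y) - θ (sl (c z + τ' • d z) y)| ≤ 1 / 2 * |τ - τ'| := by
  have h := hθ.lip y hy _ hτ _ hτ'
  rw [dist_add_left, dist_eq_norm, ← sub_smul, norm_smul, Real.norm_eq_abs] at h
  refine le_of_mul_le_mul_left (h.trans ?_) hε
  nlinarith [D.norm_d z, abs_nonneg (τ - τ')]

lemma SlideData.height_unique (D : SlideData p V V₀ U sl c d ε) (hε : 0 < ε)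
    (hθ : IsSlow V U sl ε θ) {z : Z} {y : Y} (hy : y ∈ V) {τ τ' : ℝ}
    (hτU : c z + τ • d z ∈ U) (hτU' : c z + τ' • d z ∈ U)
    (hτ : θ (sl (c z + τ • d z) y) = τ) (hτ' : θ (sl (c z + τ' • d z) y) = τ') : τ = τ' := by
  have h := D.lip hε hθ hy hτU hτU'
  rw [hτ, hτ'] at h
  have := abs_nonneg (τ - τ')
  exact sub_eq_zero.1 (abs_eq_zero.1 (by linarith))

/-- The value of `slideTo` at a point of `V₀`. -/
lemma SlideData.slideTo_spec (D : SlideData p V V₀ U sl c d ε) (hθ : IsSlow V U sl ε θ)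
    (hθ' : IsSlow V U sl ε θ') {q : Z × Y} (hq : q ∈ level p c d θ') (hqV : q.2 ∈ V₀) :
    ∃ τ ∈ Set.Icc (0 : ℝ) 1, c q.1 + τ • d q.1 ∈ U ∧ θ (sl (c q.1 + τ • d q.1) q.2) = τ ∧
      slideTo V₀ sl c d θ q = sl (c q.1 + τ • d q.1) q.2 := by
  have hex := exists_height D.slide hθ.cont hθ.mem (D.subset hqV) (D.norm_d q.1)
    (D.closedBall_subset' hθ'.mem hq hqV)
  refine ⟨_, hex.choose_spec.1, D.add_mem hθ'.mem hq hqV hex.choose_spec.1,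
    hex.choose_spec.2, ?_⟩
  rw [slideTo, dif_pos ⟨hqV, hex⟩]

lemma SlideData.slideTo_eq (D : SlideData p V V₀ U sl c d ε) (hε : 0 < ε) (hθ : IsSlow V U sl ε θ)
    (hθ' : IsSlow V U sl ε θ') {q : Z × Y} (hq : q ∈ level p c d θ') (hqV : q.2 ∈ V₀)
    {τ : ℝ} (hτ : τ ∈ Set.Icc (0 : ℝ) 1) (h : θ (sl (c q.1 + τ • d q.1) q.2) = τ) :
    slideTo V₀ sl c d θ q = sl (c q.1 + τ • d q.1) q.2 := by
  obtain ⟨τ', -, hU', h', e⟩ := D.slideTo_spec hθ hθ' hq hqV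
  rw [e, D.height_unique hε hθ (D.subset hqV) hU' (D.add_mem hθ'.mem hq hqV hτ) h' h]

lemma slideTo_of_notMem {Y B Z : Type*} [NormedAddCommGroup B] [NormedSpace ℝ B] {V₀ : Set Y}
    {sl : B → Y → Y} {c d : Z → B} {θ : Y → ℝ} {q : Z × Y} (hq : q.2 ∉ V₀) :
    slideTo V₀ sl c d θ q = q.2 := by
  rw [slideTo, dif_neg fun h => hq h.1]

/-- Where the two level sets agree, `slideTo` does not move. -/
lemma SlideData.slideTo_eq_self (D : SlideData p V V₀ U sl c d ε) (hε : 0 < ε)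
    (hθ : IsSlow V U sl ε θ) (hθ' : IsSlow V U sl ε θ') {q : Z × Y} (hq : q ∈ level p c d θ')
    (h : θ q.2 = θ' q.2) : slideTo V₀ sl c d θ q = q.2 := by
  by_cases hqV : q.2 ∈ V₀
  · have hp : c q.1 + θ q.2 • d q.1 = p q.2 := by rw [h]; exact hq.symm
    have hs : sl (c q.1 + θ q.2 • d q.1) q.2 = q.2 := by rw [hp, D.slide.self _ (D.subset hqV)]
    rw [D.slideTo_eq hε hθ hθ' hq hqV (hθ.mem q.2) (by rw [hs]), hs]
  · exact slideTo_of_notMem hqV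

lemma SlideData.slideTo_mem_level (D : SlideData p V V₀ U sl c d ε)
    (hθ : IsSlow V U sl ε θ) (hθ' : IsSlow V U sl ε θ') (hS : ∀ y ∉ V₀, θ y = θ' y) {q : Z × Y}
    (hq : q ∈ level p c d θ') : (q.1, slideTo V₀ sl c d θ q) ∈ level p c d θ := by
  by_cases hqV : q.2 ∈ V₀
  · obtain ⟨τ, -, hU, h, e⟩ := D.slideTo_spec hθ hθ' hq hqV
    simp only [level, Set.mem_ofPred_eq, e, h]
    rw [D.slide.apply_slide _ (D.subset hqV) _ hU]
  · simp only [level, Set.mem_ofPred_eq, slideTo_of_notMem hqV, hS _ hqV]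
    exact hq

/-- Moving to the level set of `θ` and back to the level set of `θ'` is the identity. The moved
point may leave `V₀`, but then it has not moved at all. -/
lemma SlideData.slideTo_slideTo (D : SlideData p V V₀ U sl c d ε) (hε : 0 < ε)
    (hθ : IsSlow V U sl ε θ) (hθ' : IsSlow V U sl ε θ') (hS : ∀ y ∉ V₀, θ y = θ' y) {q : Z × Y}
    (hq : q ∈ level p c d θ') :
    slideTo V₀ sl c d θ' (q.1, slideTo V₀ sl c d θ q) = q.2 := by
  by_cases hqV : q.2 ∈ V₀
  · have hmem := D.slideTo_mem_level hθ hθ' hS hq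
    obtain ⟨τ, hτ, hU, h, e⟩ := D.slideTo_spec hθ hθ' hq hqV
    have hp : c q.1 + θ' q.2 • d q.1 = p q.2 := hq.symm
    have hs : sl (c q.1 + θ' q.2 • d q.1) q.2 = q.2 := by rw [hp, D.slide.self _ (D.subset hqV)]
    have hpU : c q.1 + θ' q.2 • d q.1 ∈ U := hp ▸ D.slide.apply_mem _ (D.subset hqV)
    rw [e] at hmem ⊢
    by_cases hqV' : sl (c q.1 + τ • d q.1) q.2 ∈ V₀
    · have hss := D.slide.slide_slide _ (D.subset hqV) _ hpU _ hU
      rw [D.slideTo_eq hε hθ' hθ hmem hqV' (hθ'.mem q.2) (by simp only [hss, hs])]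
      simp only [hss, hs]
    · rw [slideTo_of_notMem hqV']
      -- both parameters give the point of the horizontal slice on the level set of `θ'`
      have : τ = θ' q.2 := D.height_unique hε hθ' (D.subset hqV) hU hpU
        (by rw [← hS _ hqV', h]) (by rw [hs])
      simp only [this, hs]
  · rw [slideTo_of_notMem hqV, slideTo_of_notMem hqV]

lemma SlideData.continuousOn_slideTo (D : SlideData p V V₀ U sl c d ε) (hε : 0 < ε)
    (hθ : IsSlow V U sl ε θ) (hθ' : IsSlow V U sl ε θ') (hSc : IsClosed S) (hSV : S ⊆ V₀)
    (hS : ∀ y ∉ S, θ y = θ' y) :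
    ContinuousOn (slideTo V₀ sl c d θ) (level p c d θ') := by
  intro q hq
  by_cases hqV : q.2 ∈ V₀
  -- on `V₀` the height is continuous; off `S` nothing moves
  · have hopen : IsOpen {q : Z × Y | q.2 ∈ V₀} := D.isOpen.preimage continuous_snd
    rw [← continuousWithinAt_inter (hopen.mem_nhds hqV)]
    set A := level p c d θ' ∩ {q : Z × Y | q.2 ∈ V₀} with hA
    have hqA : q ∈ A := ⟨hq, hqV⟩
    choose! τ hτ hτU hτe he using fun (q : Z × Y) (h : q ∈ A) =>
      D.slideTo_spec hθ hθ' h.1 h.2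
    have hcsl : ∀ t : Z × Y → ℝ, ContinuousWithinAt t A q → (∀ x ∈ A, t x ∈ Set.Icc (0 : ℝ) 1) →
        ContinuousWithinAt (fun x : Z × Y => sl (c x.1 + t x • d x.1) x.2) A q := by
      intro t htc ht
      refine (D.slide.cont (c q.1 + t q • d q.1, q.2)
        ⟨D.add_mem hθ'.mem hq hqV (ht q hqA), D.subset hqV⟩).comp
        (f := fun x : Z × Y => (c x.1 + t x • d x.1, x.2)) ?_ ?_
      · have h1 := (D.cont_c.comp continuous_fst).continuousWithinAt (s := A) (x := q)
        have h2 := (D.cont_d.comp continuous_fst).continuousWithinAt (s := A) (x := q)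
        exact (h1.add (htc.smul h2)).prodMk continuousWithinAt_snd
      · intro x hx
        exact ⟨D.add_mem hθ'.mem hx.1 hx.2 (ht x hx), D.subset hx.2⟩
    have hτc : ContinuousWithinAt τ A q := by
      have h0 : ContinuousWithinAt (fun x : Z × Y => θ (sl (c x.1 + τ q • d x.1) x.2)) A q :=
        hθ.cont.continuousAt.comp_continuousWithinAt
          (hcsl (fun _ => τ q) continuousWithinAt_const fun _ _ => hτ q hqA)
      rw [ContinuousWithinAt, tendsto_iff_dist_tendsto_zero] at h0 ⊢
      refine squeeze_zero' (Filter.Eventually.of_forall fun _ => dist_nonneg) ?_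
        (by simpa using h0.const_mul 2)
      filter_upwards [self_mem_nhdsWithin] with x hx
      rw [dist_comm, dist_comm (θ _), Real.dist_eq, Real.dist_eq]
      exact height_dist_le (f := fun t => θ (sl (c q.1 + t • d q.1) q.2))
        (g := fun t => θ (sl (c x.1 + t • d x.1) x.2)) (hτe q hqA) (hτe x hx)
        (D.lip hε hθ (D.subset hx.2) (D.add_mem hθ'.mem hx.1 hx.2 (hτ q hqA)) (hτU x hx))
    exact (hcsl τ hτc hτ).congr (fun x hx => he x hx) (he q hqA)
  · have hopen : IsOpen {q : Z × Y | q.2 ∉ S} := hSc.isOpen_compl.preimage continuous_snd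
    rw [← continuousWithinAt_inter (hopen.mem_nhds fun h => hqV (hSV h))]
    refine continuousWithinAt_snd.congr (fun x hx => ?_) ?_
    · exact D.slideTo_eq_self hε hθ hθ' hx.1 (hS _ hx.2)
    · exact slideTo_of_notMem hqV

/-- The fragmentation step: changing the cut-off function inside the domain of a horizontal
structure does not change the family of level sets. -/
lemma SlideData.nonempty_fibHomeo (D : SlideData p V V₀ U sl c d ε) (hε : 0 < ε)
    (hθ : IsSlow V U sl ε θ) (hθ' : IsSlow V U sl ε θ') (hSc : IsClosed S) (hSV : S ⊆ V₀)
    (hS : ∀ y ∉ S, θ y = θ' y) :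
    Nonempty (FibHomeo (level p c d θ) (level p c d θ')) := by
  have hS₀ : ∀ y ∉ V₀, θ y = θ' y := fun y hy => hS y fun h => hy (hSV h)
  have hS' : ∀ y ∉ S, θ' y = θ y := fun y hy => (hS y hy).symm
  have hS₀' : ∀ y ∉ V₀, θ' y = θ y := fun y hy => (hS₀ y hy).symm
  exact FibHomeo.nonempty_of_maps
    (slideTo V₀ sl c d θ') (slideTo V₀ sl c d θ)
    (D.continuousOn_slideTo hε hθ' hθ hSc hSV hS')
    (D.continuousOn_slideTo hε hθ hθ' hSc hSV hS)
    (fun q hq => D.slideTo_mem_level hθ' hθ hS₀' hq) (fun q hq => D.slideTo_mem_level hθ hθ' hS₀ hq)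
    (fun q hq => D.slideTo_slideTo hε hθ' hθ hS₀' hq)
    (fun q hq => D.slideTo_slideTo hε hθ hθ' hS₀ hq)

end Slide

/-! ### Short parallel transport from a partition of unity -/

/-- Short parallel transport exists uniformly for `p` over `K`: the fibres over nearby points,
one of them in `K`, are homeomorphic, and the homeomorphism can be chosen to depend continuously on
parameters when the points do. -/
def HasShortTransport {Y B : Type*} [TopologicalSpace Y] [NormedAddCommGroup B]
    (p : Y → B) (K : Set B) : Prop :=
  ∃ ε > 0, ∀ (Z : Type) [TopologicalSpace Z] (c c' : Z → B), Continuous c → Continuous c' →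
    (∀ z, c z ∈ K) → (∀ z, dist (c' z) (c z) ≤ ε) →
    Nonempty (FibHomeo {q : Z × Y | p q.2 = c q.1} {q : Z × Y | p q.2 = c' q.1})

/-- The level families of the partial sums of a partition of unity subordinate to domains of
horizontal structures are all homeomorphic. -/
lemma nonempty_fibHomeo_level_sum {Y B Z ι : Type*} [TopologicalSpace Y] [NormedAddCommGroup B]
    [NormedSpace ℝ B] [TopologicalSpace Z] {p : Y → B} {V V₀ : ι → Set Y} {U : ι → Set B}
    {sl : ι → B → Y → Y} {χ : ι → Y → ℝ} {c d : Z → B} {ε : ℝ} (hε : 0 < ε)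
    (D : ∀ i, SlideData p (V i) (V₀ i) (U i) (sl i) c d ε)
    (hslow : ∀ i s, IsSlow (V i) (U i) (sl i) ε (fun y => ∑ j ∈ s, χ j y))
    (hsupp : ∀ i, tsupport (χ i) ⊆ V₀ i) (s : Finset ι) :
    Nonempty (FibHomeo (level p c d fun _ => 0) (level p c d fun y => ∑ j ∈ s, χ j y)) := by
  classical
  induction s using Finset.induction_on with
  | empty =>
    have h : level p c d (fun _ => 0) = level p c d fun y => ∑ j ∈ ∅, χ j y := by simp
    exact ⟨FibHomeo.ofEq h⟩
  | insert i s hi ih =>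
    obtain ⟨Φ⟩ := ih
    obtain ⟨Ψ⟩ := (D i).nonempty_fibHomeo hε (hslow i s) (hslow i (insert i s))
      (isClosed_tsupport (χ i)) (hsupp i) fun y hy => by
        rw [Finset.sum_insert hi, image_eq_zero_of_notMem_tsupport hy, zero_add]
    exact ⟨Φ.trans Ψ⟩

/-- Fragmentation: the function `θ` in the equation `p y = c z + θ y • (c' z - c z)` is raised
from `0` to `1` by adding one member of a partition of unity at a time. -/
lemma hasShortTransport_of_slides {Y B ι : Type*} [TopologicalSpace Y] [NormedAddCommGroup B]
    [NormedSpace ℝ B] [Fintype ι] {p : Y → B} {V V₀ : ι → Set Y} {U : ι → Set B}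
    {sl : ι → B → Y → Y} {χ : ι → Y → ℝ} {e : ι → ℝ} {C : Set B} {r : ℝ} (hr : 0 < r)
    (he : ∀ i, 0 < e i) (hsl : ∀ i, IsSlide p (V i) (U i) (sl i)) (hV₀ : ∀ i, IsOpen (V₀ i))
    (hV : ∀ i, V₀ i ⊆ V i) (hball : ∀ i, ∀ y ∈ V₀ i, Metric.closedBall (p y) (e i) ⊆ U i)
    (hχ : ∀ i, Continuous (χ i)) (hχ0 : ∀ i y, 0 ≤ χ i y) (hχ1 : ∀ y, ∑ i, χ i y ≤ 1)
    (hsupp : ∀ i, tsupport (χ i) ⊆ V₀ i)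
    (hlip : ∀ i j, ∃ L, ∀ y ∈ V i, ∀ u ∈ U i, ∀ v ∈ U i,
      |χ j (sl i u y) - χ j (sl i v y)| ≤ L * dist u v)
    (hC : ∀ y, p y ∈ Metric.cthickening r C → ∑ i, χ i y = 1) :
    HasShortTransport p C := by
  choose L hL using hlip
  set M : ℝ := ∑ i, ∑ j, |L i j| with hM
  have hM0 : 0 ≤ M := Finset.sum_nonneg fun i _ => Finset.sum_nonneg fun j _ => abs_nonneg _
  -- all the bounds that the displacement has to respect
  obtain ⟨ε, hε, hεr, hεM, hεe⟩ : ∃ ε : ℝ, 0 < ε ∧ ε ≤ r ∧ ε * M ≤ 1 / 2 ∧ ∀ i, 2 * ε ≤ e i := by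
    have h1 : ∀ᶠ ε : ℝ in 𝓝[>] 0, ε ≤ r :=
      (eventually_le_nhds hr).filter_mono nhdsWithin_le_nhds
    have h2 : ∀ᶠ ε : ℝ in 𝓝[>] 0, ε * M ≤ 1 / 2 := by
      have : Filter.Tendsto (fun ε : ℝ => ε * M) (𝓝 0) (𝓝 (0 * M)) :=
        (continuous_id.mul continuous_const).tendsto 0
      rw [zero_mul] at this
      exact (this.eventually_le_const (by norm_num)).filter_mono nhdsWithin_le_nhds
    have h3 : ∀ᶠ ε : ℝ in 𝓝[>] 0, ∀ i, 2 * ε ≤ e i := by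
      rw [Filter.eventually_all]
      intro i
      have : Filter.Tendsto (fun ε : ℝ => 2 * ε) (𝓝 0) (𝓝 (2 * 0)) :=
        (continuous_const.mul continuous_id).tendsto 0
      rw [mul_zero] at this
      exact (this.eventually_le_const (he i)).filter_mono nhdsWithin_le_nhds
    obtain ⟨ε, ⟨h1, h2, h3⟩, h0⟩ := ((h1.and (h2.and h3)).and self_mem_nhdsWithin).exists
    exact ⟨ε, h0, h1, h2, h3⟩
  have hslow : ∀ i s, IsSlow (V i) (U i) (sl i) ε (fun y => ∑ j ∈ s, χ j y) := by
    refine fun i s => ⟨continuous_finsetSum _ fun j _ => hχ j, fun y =>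
      ⟨Finset.sum_nonneg fun j _ => hχ0 j y, (Finset.sum_le_sum_of_subset_of_nonneg
        (Finset.subset_univ s) fun j _ _ => hχ0 j y).trans (hχ1 y)⟩, fun y hy u hu v hv => ?_⟩
    have h1 : |∑ j ∈ s, χ j (sl i u y) - ∑ j ∈ s, χ j (sl i v y)| ≤ M * dist u v := by
      rw [← Finset.sum_sub_distrib]
      calc _ ≤ ∑ j ∈ s, |χ j (sl i u y) - χ j (sl i v y)| := Finset.abs_sum_le_sum_abs _ _
        _ ≤ ∑ j ∈ s, |L i j| * dist u v := Finset.sum_le_sum fun j _ =>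
            (hL i j y hy u hu v hv).trans (by gcongr; exact le_abs_self _)
        _ ≤ ∑ j, |L i j| * dist u v := Finset.sum_le_sum_of_subset_of_nonneg
            (Finset.subset_univ s) fun j _ _ => by positivity
        _ = (∑ j, |L i j|) * dist u v := (Finset.sum_mul ..).symm
        _ ≤ M * dist u v := by
            gcongr
            exact Finset.single_le_sum (f := fun i => ∑ j, |L i j|)
              (fun i _ => Finset.sum_nonneg fun j _ => abs_nonneg _) (Finset.mem_univ i)
    calc _ ≤ ε * (M * dist u v) := by gcongr
      _ = ε * M * dist u v := (mul_assoc ..).symm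
      _ ≤ _ := by gcongr
  refine ⟨ε, hε, fun Z _ c c' hc hc' hcC hcc' => ?_⟩
  have hd : ∀ z, ‖c' z - c z‖ ≤ ε := fun z => by rw [← dist_eq_norm]; exact hcc' z
  have D : ∀ i, SlideData p (V i) (V₀ i) (U i) (sl i) c (fun z => c' z - c z) ε := fun i =>
    ⟨hsl i, hV₀ i, hV i, fun y hy => (Metric.closedBall_subset_closedBall (hεe i)).trans
      (hball i y hy), hc, hc'.sub hc, hd⟩
  obtain ⟨Φ⟩ := nonempty_fibHomeo_level_sum hε D hslow hsupp Finset.univ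
  have h0 : {q : Z × Y | p q.2 = c q.1} = level p c (fun z => c' z - c z) fun _ => 0 := by
    ext q; simp [level]
  have h1 : level p c (fun z => c' z - c z) (fun y => ∑ i, χ i y) =
      {q : Z × Y | p q.2 = c' q.1} := by
    have key : ∀ q : Z × Y, dist (p q.2) (c q.1) ≤ ε → ∑ i, χ i q.2 = 1 := fun q h =>
      hC _ (Metric.mem_cthickening_of_dist_le _ _ _ _ (hcC q.1) (h.trans hεr))
    ext q
    simp only [level, Set.mem_ofPred_eq]
    constructor
    · intro h
      have := key q (by
        rw [h, dist_self_add_left, norm_smul,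
          Real.norm_of_nonneg (Finset.sum_nonneg fun i _ => hχ0 i q.2)]
        exact (mul_le_of_le_one_left (norm_nonneg _) (hχ1 _)).trans (hd _))
      rw [h, this, one_smul, add_sub_cancel]
    · intro h
      rw [key q (h ▸ hcc' q.1), one_smul, add_sub_cancel, h]
  exact ⟨((FibHomeo.ofEq h0).trans Φ).trans (FibHomeo.ofEq h1)⟩

/-- The horizontal structure of a chart with values in a product `B × K` whose first coordinate
is `p`. -/
lemma isSlide_of_chart {Y B K : Type*} [TopologicalSpace Y] [NormedAddCommGroup B]
    [NormedAddCommGroup K] {p : Y → B} (ψ : OpenPartialHomeomorph Y (B × K))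
    (hψ : ∀ y ∈ ψ.source, (ψ y).1 = p y) {U : Set B} {N : Set K} (hUN : U ×ˢ N ⊆ ψ.target) :
    IsSlide p (ψ.source ∩ ψ ⁻¹' (U ×ˢ N)) U (fun u y => ψ.symm (u, (ψ y).2)) := by
  have hmem : ∀ y ∈ ψ.source ∩ ψ ⁻¹' (U ×ˢ N), ∀ u ∈ U, (u, (ψ y).2) ∈ U ×ˢ N :=
    fun y hy u hu => ⟨hu, hy.2.2⟩
  have hψs : ∀ y ∈ ψ.source ∩ ψ ⁻¹' (U ×ˢ N), ∀ u ∈ U,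
      ψ (ψ.symm (u, (ψ y).2)) = (u, (ψ y).2) := fun y hy u hu =>
    ψ.right_inv (hUN (hmem y hy u hu))
  refine ⟨fun y hy => hψ y hy.1 ▸ hy.2.1, fun y hy u hu => ⟨ψ.map_target (hUN (hmem y hy u hu)),
    ?_⟩, fun y hy u hu => ?_, fun y hy => ?_, fun y hy u hu v hv => ?_, ?_⟩
  · rw [Set.mem_preimage, hψs y hy u hu]
    exact hmem y hy u hu
  · rw [← hψ _ (ψ.map_target (hUN (hmem y hy u hu))), hψs y hy u hu]
  · rw [← hψ y hy.1]
    exact ψ.left_inv hy.1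
  · simp only [hψs y hy v hv]
  · refine ψ.continuousOn_symm.comp (f := fun q : B × Y => (q.1, (ψ q.2).2)) ?_
      fun q hq => hUN (hmem _ hq.2 _ hq.1)
    refine continuousOn_fst.prodMk (continuous_snd.comp_continuousOn ?_)
    exact ψ.continuousOn.comp continuousOn_snd fun q hq => hq.2.1

/-! ### Submersions and short parallel transport -/

/-- The implicit function theorem with a continuously differentiable inverse chart. -/
lemma exists_chart_of_surjective_fderiv {𝕜 E F : Type*} [RCLike 𝕜] [NormedAddCommGroup E]
    [NormedSpace 𝕜 E] [FiniteDimensional 𝕜 E] [NormedAddCommGroup F] [NormedSpace 𝕜 F]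
    [FiniteDimensional 𝕜 F] {f : E → F} {a : E} (hf : ContDiffAt 𝕜 1 f a)
    (hs : Function.Surjective (fderiv 𝕜 f a)) :
    ∃ (K : Submodule 𝕜 E) (e : OpenPartialHomeomorph E (F × K)),
      a ∈ e.source ∧ (∀ x, (e x).1 = f x) ∧ ContDiffAt 𝕜 1 e.symm (e a) := by
  have := FiniteDimensional.complete 𝕜 E
  obtain ⟨P, hP⟩ := (fderiv 𝕜 f a).ker_closedComplemented_of_finiteDimensional_range
  have hbij : Function.Bijective ((fderiv 𝕜 f a).prod P) := by
    constructor
    · rw [injective_iff_map_eq_zero]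
      intro x hx
      have h1 : fderiv 𝕜 f a x = 0 := congrArg Prod.fst hx
      have h2 : P x = 0 := congrArg Prod.snd hx
      have h3 := hP ⟨x, h1⟩
      rw [h2] at h3
      exact (congrArg Subtype.val h3).symm
    · rintro ⟨v, w⟩
      obtain ⟨x, rfl⟩ := hs v
      have hk : ∀ k : (fderiv 𝕜 f a).ker, fderiv 𝕜 f a k = 0 := fun k => k.2
      refine ⟨x + ((w - P x : (fderiv 𝕜 f a).ker) : E), Prod.ext ?_ ?_⟩
      · simp only [ContinuousLinearMap.prod_apply, map_add]
        exact (congrArg (_ + ·) (hk _)).trans (add_zero _)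
      · simp only [ContinuousLinearMap.prod_apply, map_add]
        exact (congrArg (_ + ·) (hP _)).trans (add_sub_cancel _ _)
  let A : E ≃L[𝕜] F × (fderiv 𝕜 f a).ker :=
    (LinearEquiv.ofBijective ((fderiv 𝕜 f a).prod P).toLinearMap hbij).toContinuousLinearEquiv
  have hg : ContDiffAt 𝕜 1 (fun x => (f x, P x)) a := hf.prodMk P.contDiff.contDiffAt
  have hg' : HasFDerivAt (fun x => (f x, P x)) (A : E →L[𝕜] F × (fderiv 𝕜 f a).ker) a :=
    (hf.differentiableAt one_ne_zero).hasFDerivAt.prodMk P.hasFDerivAt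
  exact ⟨_, hg.toOpenPartialHomeomorph _ hg' one_ne_zero,
    hg.mem_toOpenPartialHomeomorph_source hg' one_ne_zero, fun x => rfl,
    hg.to_localInverse hg' one_ne_zero⟩

/-- A map that is continuously differentiable at the points of a compact set is
Lipschitz on this set. -/
lemma exists_lipschitzOnWith_of_contDiffAt {E F : Type*} [NormedAddCommGroup E] [NormedSpace ℝ E]
    [NormedAddCommGroup F] [NormedSpace ℝ F] {f : E → F} {s : Set E} (hs : IsCompact s)
    (hf : ∀ x ∈ s, ContDiffAt ℝ 1 f x) : ∃ L, LipschitzOnWith L f s := by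
  refine LocallyLipschitzOn.exists_lipschitzOnWith_of_compact hs fun x hx => ?_
  obtain ⟨L, t, ht, hL⟩ := (hf x hx).exists_lipschitzOnWith
  exact ⟨L, t, mem_nhdsWithin_of_mem_nhds ht, hL⟩

section Manifold

variable {E : Type*} [NormedAddCommGroup E] [NormedSpace ℂ E]
  {Y : Type*} [TopologicalSpace Y] [ChartedSpace E Y]

/-- A complex analytic manifold is a smooth real manifold. -/
lemma isManifold_real [IsManifold 𝓘(ℂ, E) ω Y] : IsManifold 𝓘(ℝ, E) ∞ Y := by
  refine isManifold_of_contDiffOn _ _ _ fun e e' he he' => ?_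
  have h := HasGroupoid.compatible (G := contDiffGroupoid ω 𝓘(ℂ, E)) he he'
  rw [contDiffGroupoid, mem_groupoid_of_pregroupoid] at h
  have h1 : ContDiffOn ℂ ω (e.symm ≫ₕ e') (e.symm ≫ₕ e').source := by
    simpa [contDiffPregroupoid] using h.1
  simpa using (h1.restrict_scalars ℝ).of_le le_top

/-- Near a point where `G` is a submersion there is a horizontal structure for `G`, and smooth
functions are Lipschitz along its horizontal slices. -/
lemma exists_slide [FiniteDimensional ℂ E] [IsManifold 𝓘(ℂ, E) ω Y]
    {B : Type*} [NormedAddCommGroup B] [NormedSpace ℂ B] [FiniteDimensional ℂ B] {G : Y → B}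
    (hG : ContMDiff 𝓘(ℂ, E) 𝓘(ℂ, B) ω G) {y₀ : Y}
    (hs : Function.Surjective (mfderiv 𝓘(ℂ, E) 𝓘(ℂ, B) G y₀)) :
    ∃ (V V₀ : Set Y) (U : Set B) (sl : B → Y → Y) (ε : ℝ), 0 < ε ∧ IsSlide G V U sl ∧
      IsOpen V₀ ∧ y₀ ∈ V₀ ∧ V₀ ⊆ V ∧ (∀ y ∈ V₀, Metric.closedBall (G y) ε ⊆ U) ∧
      ∀ χ : Y → ℝ, ContMDiff 𝓘(ℝ, E) 𝓘(ℝ) ∞ χ → ∃ L, ∀ y ∈ V, ∀ u ∈ U, ∀ v ∈ U,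
        |χ (sl u y) - χ (sl v y)| ≤ L * dist u v := by
  have : IsManifold 𝓘(ℝ, E) ∞ Y := isManifold_real
  set φ := chartAt E y₀ with hφ
  have hy₀ : y₀ ∈ φ.source := mem_chart_source E y₀
  have hf : ContDiffAt ℂ 1 (G ∘ φ.symm) (φ y₀) := by
    have h1 : ContMDiffOn 𝓘(ℂ, E) 𝓘(ℂ, B) ω (G ∘ φ.symm) φ.target :=
      hG.comp_contMDiffOn (contMDiffOn_chart_symm :
        ContMDiffOn 𝓘(ℂ, E) 𝓘(ℂ, E) ω φ.symm φ.target)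
    exact ((contMDiffOn_iff_contDiffOn.1 h1).contDiffAt
      (φ.open_target.mem_nhds (φ.map_source hy₀))).of_le le_top
  have hfd : Function.Surjective (fderiv ℂ (G ∘ φ.symm) (φ y₀)) := by
    have h1 : MDifferentiableAt 𝓘(ℂ, E) 𝓘(ℂ, B) G y₀ := hG.mdifferentiableAt (by simp)
    have h2 : (mfderiv 𝓘(ℂ, E) 𝓘(ℂ, B) G y₀ : E →L[ℂ] B) =
        fderiv ℂ (G ∘ φ.symm) (φ y₀) := by
      refine h1.mfderiv.trans ?_
      simp [writtenInExtChartAt, fderivWithin_univ, hφ, chartAt_self_eq]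
      rfl
    rw [← h2]
    exact hs
  obtain ⟨K, e, he, hef, hsymm⟩ := exists_chart_of_surjective_fderiv hf hfd
  set ψ := φ.trans e with hψ
  have hψsource : ∀ y ∈ ψ.source, (ψ y).1 = G y := by
    intro y hy
    rw [hψ, OpenPartialHomeomorph.trans_source] at hy
    simp [hψ, hef, φ.left_inv hy.1]
  have hyψ : y₀ ∈ ψ.source := by
    rw [hψ, OpenPartialHomeomorph.trans_source]
    exact ⟨hy₀, he⟩
  -- a polydisc in the target on which the inverse chart is continuously differentiable
  obtain ⟨r, hr, hrt⟩ : ∃ r > 0, Metric.closedBall (ψ y₀) r ⊆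
      ψ.target ∩ {q | ContDiffAt ℝ 1 e.symm q} := by
    refine Metric.nhds_basis_closedBall.mem_iff.1 (Filter.inter_mem
      (ψ.open_target.mem_nhds (ψ.map_source hyψ)) ?_)
    have : ContDiffAt ℝ 1 e.symm (ψ y₀) := hsymm.restrict_scalars ℝ
    exact this.eventually (by simp)
  rw [← closedBall_prod_same] at hrt
  set b := (ψ y₀).1 with hb
  set z := (ψ y₀).2 with hz
  refine ⟨ψ.source ∩ ψ ⁻¹' (Metric.closedBall b r ×ˢ Metric.closedBall z r),
    ψ.source ∩ ψ ⁻¹' (Metric.ball b (r / 2) ×ˢ Metric.ball z r), Metric.closedBall b r,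
    fun u y => ψ.symm (u, (ψ y).2), r / 2, by positivity,
    isSlide_of_chart ψ hψsource (hrt.trans Set.inter_subset_left),
    ψ.isOpen_inter_preimage (Metric.isOpen_ball.prod Metric.isOpen_ball), ?_, ?_, ?_, ?_⟩
  · exact ⟨hyψ, Metric.mem_ball_self (by positivity), Metric.mem_ball_self hr⟩
  · have h1 : Metric.ball b (r / 2) ⊆ Metric.closedBall b r :=
      Metric.ball_subset_closedBall.trans (Metric.closedBall_subset_closedBall (by linarith))
    exact Set.inter_subset_inter_right _ (Set.preimage_mono
      (Set.prod_mono h1 Metric.ball_subset_closedBall))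
  · rintro y ⟨hy, hyb, -⟩
    rw [← hψsource y hy]
    refine Metric.closedBall_subset_closedBall' ?_
    have := (Metric.mem_ball.1 hyb).le
    linarith
  · intro χ hχ
    have hFD : FiniteDimensional ℝ E := FiniteDimensional.complexToReal E
    have hFB : FiniteDimensional ℝ B := FiniteDimensional.complexToReal B
    have hFK : FiniteDimensional ℝ K := FiniteDimensional.complexToReal K
    have hPB : ProperSpace B := FiniteDimensional.proper_real B
    have hPK : ProperSpace K := FiniteDimensional.proper_real K
    have hχφ : ContDiffOn ℝ ∞ (χ ∘ φ.symm) φ.target := by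
      rw [← contMDiffOn_iff_contDiffOn]
      exact hχ.comp_contMDiffOn (contMDiffOn_chart_symm :
        ContMDiffOn 𝓘(ℝ, E) 𝓘(ℝ, E) ∞ φ.symm φ.target)
    obtain ⟨L, hL⟩ := exists_lipschitzOnWith_of_contDiffAt (f := χ ∘ ψ.symm)
      ((isCompact_closedBall b r).prod (isCompact_closedBall z r)) fun q hq => by
        have hqt : e.symm q ∈ φ.target := by
          have := (hrt hq).1
          rw [hψ, OpenPartialHomeomorph.trans_target] at this
          exact this.2
        exact ((((hχφ.contDiffAt (φ.open_target.mem_nhds hqt)).of_le (by simp)).comp q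
          (hrt hq).2 : ContDiffAt ℝ 1 ((χ ∘ φ.symm) ∘ e.symm) q))
    refine ⟨L, fun y hy u hu v hv => ?_⟩
    have h1 := hL.dist_le_mul (u, (ψ y).2) ⟨hu, hy.2.2⟩ (v, (ψ y).2) ⟨hv, hy.2.2⟩
    rw [Real.dist_eq, Prod.dist_eq, dist_self, max_eq_left dist_nonneg] at h1
    exact h1

/-- Over a compact set `C` of regular values, a map that is proper near `C` has short parallel
transport. -/
lemma hasShortTransport_of_compact [FiniteDimensional ℂ E] [IsManifold 𝓘(ℂ, E) ω Y] [T2Space Y]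
    [SecondCountableTopology Y]
    {B : Type*} [NormedAddCommGroup B] [NormedSpace ℂ B] [FiniteDimensional ℂ B] {G : Y → B}
    (hG : ContMDiff 𝓘(ℂ, E) 𝓘(ℂ, B) ω G) {C O : Set B} (hC : IsCompact C) (hO : IsOpen O)
    (hCO : C ⊆ O) (hs : ∀ y, G y ∈ O → Function.Surjective (mfderiv 𝓘(ℂ, E) 𝓘(ℂ, B) G y))
    (hproper : ∀ D ⊆ O, IsCompact D → IsCompact (G ⁻¹' D)) : HasShortTransport G C := by
  have : IsManifold 𝓘(ℝ, E) ∞ Y := isManifold_real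
  have hFD : FiniteDimensional ℝ E := FiniteDimensional.complexToReal E
  have hFB : FiniteDimensional ℝ B := FiniteDimensional.complexToReal B
  have hPB : ProperSpace B := FiniteDimensional.proper_real B
  have hPE : ProperSpace E := FiniteDimensional.proper_real E
  have : LocallyCompactSpace Y := ChartedSpace.locallyCompactSpace E Y
  obtain ⟨r, hr, hrO⟩ := hC.exists_cthickening_subset_open hO hCO
  have hD : IsCompact (G ⁻¹' Metric.cthickening r C) := hproper _ hrO hC.cthickening
  choose! V V₀ U sl ε hε hsl hV₀ hmem hV hball hlip using fun (y : Y) (hy : G y ∈ O) =>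
    exists_slide hG (hs y hy)
  obtain ⟨t, htD, ht⟩ := hD.elim_nhds_subcover V₀ fun y hy =>
    (hV₀ y (hrO hy)).mem_nhds (hmem y (hrO hy))
  have htO : ∀ i : t, G i ∈ O := fun i => hrO (htD i i.2)
  obtain ⟨χ, hχ⟩ := SmoothPartitionOfUnity.exists_isSubordinate 𝓘(ℝ, E) hD.isClosed
    (fun i : t => V₀ i) (fun i => hV₀ i (htO i)) (by simpa [Set.iUnion_subtype] using ht)
  refine hasShortTransport_of_slides hr (fun i : t => hε i (htO i)) (fun i => hsl i (htO i))
    (fun i => hV₀ i (htO i)) (fun i => hV i (htO i)) (fun i => hball i (htO i))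
    (fun i => (χ i).contMDiff.continuous) (fun i y => χ.nonneg i y)
    (fun y => ?_) hχ (fun i j => hlip i (htO i) _ (χ j).contMDiff) fun y hy => ?_
  · rw [← finsum_eq_sum_of_fintype]
    exact χ.sum_le_one y
  · rw [← finsum_eq_sum_of_fintype]
    exact χ.sum_eq_one hy

end Manifold

/-! ### Isotopies, parallel transport and conjugate monodromies -/

section Isotopy

variable {X Y Z : Type*} [TopologicalSpace X] [TopologicalSpace Y] [TopologicalSpace Z]

namespace Isotopic

lemma refl (φ : X ≃ₜ Y) : Isotopic φ φ :=
  ⟨fun _ => φ, φ.continuous.comp continuous_snd, φ.symm.continuous.comp continuous_snd, rfl, rfl⟩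

lemma comp {φ φ' : X ≃ₜ Y} {ψ ψ' : Y ≃ₜ Z} (h : Isotopic φ φ') (k : Isotopic ψ ψ') :
    Isotopic (φ.trans ψ) (φ'.trans ψ') := by
  obtain ⟨H, hc, hs, h0, h1⟩ := h
  obtain ⟨K, kc, ks, k0, k1⟩ := k
  refine ⟨fun t => (H t).trans (K t), ?_, ?_, by simp only [h0, k0], by simp only [h1, k1]⟩
  · exact kc.comp (continuous_fst.prodMk hc)
  · exact hs.comp (continuous_fst.prodMk ks)

/-- Transitivity, by composing `φ ⟶ ψ`, the constant `ψ⁻¹`, and `ψ ⟶ χ` pointwise. -/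
lemma trans {φ ψ χ : X ≃ₜ Y} (h : Isotopic φ ψ) (k : Isotopic ψ χ) : Isotopic φ χ := by
  have := (h.comp (refl ψ.symm)).comp k
  have e1 : (φ.trans ψ.symm).trans ψ = φ := by ext; simp
  have e2 : (ψ.trans ψ.symm).trans χ = χ := by ext; simp
  rwa [e1, e2] at this

/-- The restrictions to the ends of a homeomorphism over the unit interval are isotopic. -/
lemma of_homeo (Ψ : (I × X) ≃ₜ (I × Y)) (hΨ : ∀ q, (Ψ q).1 = q.1) {φ ψ : X ≃ₜ Y}
    (h0 : ∀ x, (Ψ (0, x)).2 = φ x) (h1 : ∀ x, (Ψ (1, x)).2 = ψ x) : Isotopic φ ψ := by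
  have hs : ∀ q, (Ψ.symm q).1 = q.1 := fun q => by rw [← hΨ, Ψ.apply_symm_apply]
  have e : ∀ t x, (t, (Ψ (t, x)).2) = Ψ (t, x) := fun t x => Prod.ext (hΨ (t, x)).symm rfl
  have es : ∀ t y, (t, (Ψ.symm (t, y)).2) = Ψ.symm (t, y) := fun t y =>
    Prod.ext (hs (t, y)).symm rfl
  refine ⟨fun t =>
    { toFun x := (Ψ (t, x)).2
      invFun y := (Ψ.symm (t, y)).2
      left_inv x := by simp only [e, Ψ.symm_apply_apply]
      right_inv y := by simp only [es, Ψ.apply_symm_apply]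
      continuous_toFun := by fun_prop
      continuous_invFun := by fun_prop }, ?_, ?_, Homeomorph.ext h0, Homeomorph.ext h1⟩
  · exact continuous_snd.comp Ψ.continuous
  · exact continuous_snd.comp Ψ.symm.continuous

end Isotopic

end Isotopy

/-- Isotopic homeomorphisms induce the same homomorphism on singular cohomology. -/
lemma Isotopic.cohomologyMap_eq {X Y : Type u} [TopologicalSpace X] [TopologicalSpace Y]
    {φ ψ : X ≃ₜ Y} (h : Isotopic φ ψ) (A : AddCommGrpCat.{u}) (n : ℕ) :
    cohomologyMap A n φ = cohomologyMap A n ψ := by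
  obtain ⟨H, hc, -, h0, h1⟩ := h
  let F : TopCat.Homotopy (TopCat.ofHom (φ : C(X, Y))) (TopCat.ofHom (ψ : C(X, Y))) :=
    { toFun := fun q => H q.1 q.2
      continuous_toFun := hc
      map_zero_left := fun x => by rw [h0]; rfl
      map_one_left := fun x => by rw [h1]; rfl }
  exact ((preadditiveYoneda.obj A).mapHomotopy
    (F.singularChainComplexFunctorObjMap (AddCommGrpCat.of (ULift.{u} ℤ))).op).homologyMap_eq n

lemma cohomologyMap_trans {X Y Z : Type u} [TopologicalSpace X] [TopologicalSpace Y]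
    [TopologicalSpace Z] (φ : X ≃ₜ Y) (ψ : Y ≃ₜ Z) (A : AddCommGrpCat.{u}) (n : ℕ) :
    cohomologyMap A n (φ.trans ψ) = cohomologyMap A n ψ ≫ cohomologyMap A n φ := by
  rw [cohomologyMap, cohomologyMap, cohomologyMap, ← Functor.map_comp]
  rfl

/-- Parallel transports along the same path are isotopic. -/
lemma IsTransport.isotopic {E B : Type*} [TopologicalSpace E] [TopologicalSpace B] {p : E → B}
    {a b : B} {γ : Path a b} {φ φ' : (p ⁻¹' {a} : Set E) ≃ₜ (p ⁻¹' {b} : Set E)}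
    (h : IsTransport p γ φ) (h' : IsTransport p γ φ') : Isotopic φ φ' := by
  obtain ⟨Φ, hΦ, hΦ0, hΦ1⟩ := h'
  obtain ⟨Φ', hΦ', hΦ0', hΦ1'⟩ := h
  have hs : ∀ q, (Φ'.symm q).1 = q.1.1 := fun q => by rw [← hΦ', Φ'.apply_symm_apply]
  have key : ∀ t x x', (Φ (t, x)).1.2 = (Φ' (t, x')).1.2 → (Φ'.symm (Φ (t, x))).2 = x' := by
    intro t x x' h
    have : Φ (t, x) = Φ' (t, x') := Subtype.ext (Prod.ext (by rw [hΦ, hΦ']) h)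
    rw [this, Φ'.symm_apply_apply]
  have h1 : Isotopic (Homeomorph.refl _) (φ'.trans φ.symm) := by
    refine Isotopic.of_homeo (Φ.trans Φ'.symm) (fun q => ?_) (fun x => ?_) fun x => ?_
    · rw [Homeomorph.trans_apply, hs, hΦ]
    · exact key 0 x x (by rw [hΦ0, hΦ0'])
    · exact key 1 x _ (by rw [hΦ1, hΦ1']; simp)
  have h2 := h1.comp (Isotopic.refl φ)
  have e : (φ'.trans φ.symm).trans φ = φ' := by ext; simp
  rwa [e] at h2

/-- A trivialization, with fibre `S`, of the pullback of `p : Y → B` along `γ : A → B`. -/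
structure Triv {A Y B : Type*} [TopologicalSpace A] [TopologicalSpace Y] (S : Type*)
    [TopologicalSpace S] (p : Y → B) (γ : A → B) where
  /-- The underlying homeomorphism of total spaces. -/
  homeo : (A × S) ≃ₜ {q : A × Y // p q.2 = γ q.1}
  fst_homeo : ∀ q, (homeo q).1.1 = q.1

namespace Triv

variable {A A' S X Y B : Type*} [TopologicalSpace A] [TopologicalSpace A'] [TopologicalSpace S]
  [TopologicalSpace X] [TopologicalSpace Y] {p : Y → B} {γ : A → B}

lemma fst_symm (T : Triv S p γ) (q : {q : A × Y // p q.2 = γ q.1}) :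
    (T.homeo.symm q).1 = q.1.1 := by
  rw [← T.fst_homeo, T.homeo.apply_symm_apply]

lemma mk_symm (T : Triv S p γ) (q : {q : A × Y // p q.2 = γ q.1}) :
    (q.1.1, (T.homeo.symm q).2) = T.homeo.symm q := Prod.ext (T.fst_symm q).symm rfl

lemma apply_val (T : Triv S p γ) (q : {q : A × Y // p q.2 = γ q.1}) :
    (T.homeo (q.1.1, (T.homeo.symm q).2)).1.2 = q.1.2 := by
  rw [T.mk_symm, T.homeo.apply_symm_apply]

lemma proj_apply (T : Triv S p γ) (q : A × S) : p (T.homeo q).1.2 = γ q.1 := by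
  rw [(T.homeo q).2, T.fst_homeo]

lemma ext_apply (T : Triv S p γ) {a : A} {x x' : S}
    (h : (T.homeo (a, x)).1.2 = (T.homeo (a, x')).1.2) : x = x' := by
  have : T.homeo (a, x) = T.homeo (a, x') :=
    Subtype.ext (Prod.ext (by rw [T.fst_homeo, T.fst_homeo]) h)
  exact congrArg Prod.snd (T.homeo.injective this)

/-- A trivialization restricts to a homeomorphism of `S` with each fibre. -/
def fibreAt (T : Triv S p γ) (a : A) (b : B) (h : γ a = b) : S ≃ₜ (p ⁻¹' {b} : Set Y) where
  toFun x := ⟨(T.homeo (a, x)).1.2, (T.proj_apply _).trans h⟩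
  invFun y := (T.homeo.symm ⟨(a, y), y.2.trans h.symm⟩).2
  left_inv x := T.ext_apply (a := a) (T.apply_val ⟨(a, (T.homeo (a, x)).1.2), _⟩)
  right_inv y := Subtype.ext (T.apply_val ⟨(a, y), y.2.trans h.symm⟩)
  continuous_toFun := by fun_prop
  continuous_invFun := by fun_prop

/-- The restriction of a trivialization along a map of the parameter spaces. -/
def pullback (T : Triv S p γ) (f : A' → A) (hf : Continuous f) (γ' : A' → B)
    (hγ : ∀ a, γ (f a) = γ' a) : Triv S p γ' where
  homeo :=
    { toFun q := ⟨(q.1, (T.homeo (f q.1, q.2)).1.2), (T.proj_apply _).trans (hγ _)⟩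
      invFun q := (q.1.1, (T.homeo.symm ⟨(f q.1.1, q.1.2), q.2.trans (hγ _).symm⟩).2)
      left_inv q := Prod.ext rfl
        (T.ext_apply (a := f q.1) (T.apply_val ⟨(f q.1, (T.homeo (f q.1, q.2)).1.2), _⟩))
      right_inv q := Subtype.ext (Prod.ext rfl
        (T.apply_val ⟨(f q.1.1, q.1.2), q.2.trans (hγ _).symm⟩))
      continuous_toFun := by fun_prop
      continuous_invFun := by fun_prop }
  fst_homeo _ := rfl

@[simp]
lemma pullback_apply (T : Triv S p γ) (f : A' → A) (hf : Continuous f) (γ' : A' → B)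
    (hγ : ∀ a, γ (f a) = γ' a) (q : A' × S) :
    ((T.pullback f hf γ' hγ).homeo q).1.2 = (T.homeo (f q.1, q.2)).1.2 := rfl

/-- A trivialization over the unit interval gives a parallel transport. -/
lemma isTransport [TopologicalSpace B] {a b : B} {γ : Path a b} (T : Triv S p (γ : I → B)) :
    IsTransport p γ ((T.fibreAt 0 a γ.source).symm.trans (T.fibreAt 1 b γ.target)) := by
  set α := T.fibreAt 0 a γ.source
  refine ⟨((Homeomorph.refl I).prodCongr α.symm).trans T.homeo, fun q => ?_, fun x => ?_,
    fun x => ?_⟩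
  · simp [T.fst_homeo]
  · exact congrArg Subtype.val (α.apply_symm_apply x)
  · rfl

end Triv

/-- The map `j` identifies the source of `f` with the fibre over `s` of the second component
of `G`, so that `f` becomes the first component. -/
structure IsSlice {X Y : Type*} [TopologicalSpace X] [TopologicalSpace Y] (f : X → ℂ)
    (G : Y → ℂ × ℂ) (s : ℂ) (j : X → Y) : Prop where
  isEmbedding : Topology.IsEmbedding j
  apply : ∀ x, G (j x) = (f x, s)
  surj : ∀ y, (G y).2 = s → ∃ x, j x = y

/-- A trivialization of `G` over a path in a slice trivializes the restriction of `G`. -/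
lemma Triv.exists_slice {A S X Y : Type*} [TopologicalSpace A] [TopologicalSpace S]
    [TopologicalSpace X] [TopologicalSpace Y] {f : X → ℂ} {G : Y → ℂ × ℂ} {s : ℂ} {j : X → Y}
    (hj : IsSlice f G s j) {γ : A → ℂ} (T : Triv S G fun a => (γ a, s)) :
    ∃ T' : Triv S f γ, ∀ q, j (T'.homeo q).1.2 = (T.homeo q).1.2 := by
  choose k hk using fun q : A × S => hj.surj (T.homeo q).1.2 (by rw [T.proj_apply])
  have hkf : ∀ q, f (k q) = γ q.1 := fun q => by
    have := hj.apply (k q)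
    rw [hk, T.proj_apply] at this
    exact (congrArg Prod.fst this).symm
  have hkc : Continuous k := by
    rw [hj.isEmbedding.continuous_iff]
    exact (by fun_prop : Continuous fun q => (T.homeo q).1.2).congr fun q => (hk q).symm
  have hjG : ∀ q : {q : A × X // f q.2 = γ q.1}, G (j q.1.2) = (γ q.1.1, s) := fun q => by
    rw [hj.apply, q.2]
  have hjc : Continuous j := hj.isEmbedding.continuous
  refine ⟨⟨⟨⟨fun q => ⟨(q.1, k q), hkf q⟩, fun q => T.homeo.symm ⟨(q.1.1, j q.1.2), hjG q⟩,
    fun q => ?_, fun q => ?_⟩, by fun_prop, by fun_prop⟩, fun _ => rfl⟩, hk⟩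
  · rw [Homeomorph.symm_apply_eq]
    exact Subtype.ext (Prod.ext (T.fst_homeo q).symm (hk q))
  · refine Subtype.ext (Prod.ext (T.fst_symm _) (hj.isEmbedding.injective ?_))
    rw [hk, T.homeo.apply_symm_apply]

/-- If the pullback of `G` along a free homotopy of loops is trivial, then the monodromies of the
restrictions of `G` along the two end loops, each contained in a slice, are conjugate. -/
lemma conjugateMonodromy_of_triv {X X' : Type u} {Y S : Type*} [TopologicalSpace X]
    [TopologicalSpace X'] [TopologicalSpace Y] [TopologicalSpace S] {f : X → ℂ} {f' : X' → ℂ}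
    {G : Y → ℂ × ℂ} {s s' : ℂ} {j : X → Y} {j' : X' → Y} (hj : IsSlice f G s j)
    (hj' : IsSlice f' G s' j') {c c' : ℂ} {r r' : ℝ} {H : I × I → ℂ × ℂ}
    (T : Triv S G H) (h0 : ∀ t, H (0, t) = (circleLoop c r t, s))
    (h1 : ∀ t, H (1, t) = (circleLoop c' r' t, s')) (hH : ∀ u, H (u, 0) = H (u, 1)) :
    ConjugateMonodromy f c r f' c' r' := by
  obtain ⟨P, hP⟩ := Triv.exists_slice hj
    (T.pullback (fun t : I => ((0 : I), t)) (by fun_prop) _ h0)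
  obtain ⟨Q, hQ⟩ := Triv.exists_slice hj'
    (T.pullback (fun t : I => ((1 : I), t)) (by fun_prop) _ h1)
  simp only [Triv.pullback_apply] at hP hQ
  have hφ := P.isTransport
  have hφ' := Q.isTransport
  set α₀ := P.fibreAt 0 _ (circleLoop c r).source
  set α₁ := P.fibreAt 1 _ (circleLoop c r).target
  set β₀ := Q.fibreAt 0 _ (circleLoop c' r').source
  set β₁ := Q.fibreAt 1 _ (circleLoop c' r').target
  -- the two ends of the loops give two trivializations of the same family
  have hk : Isotopic (α₁.trans α₀.symm) (β₁.trans β₀.symm) := by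
    let K₀ := T.pullback (fun u : I => (u, (0 : I))) (by fun_prop) (fun u => H (u, 0))
      fun _ => rfl
    let K₁ := T.pullback (fun u : I => (u, (1 : I))) (by fun_prop) (fun u => H (u, 0))
      fun u => (hH u).symm
    have key : ∀ u x x', (T.homeo ((u, 0), x')).1.2 = (T.homeo ((u, 1), x)).1.2 →
        ((K₁.homeo.trans K₀.homeo.symm) (u, x)).2 = x' := by
      intro u x x' h
      refine congrArg Prod.snd (?_ : _ = (u, x'))
      rw [Homeomorph.trans_apply, Homeomorph.symm_apply_eq]
      exact Subtype.ext (Prod.ext rfl h.symm)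
    refine Isotopic.of_homeo (K₁.homeo.trans K₀.homeo.symm) (fun q => ?_) (fun x => ?_)
      fun x => ?_
    · rw [Homeomorph.trans_apply, K₀.fst_symm, K₁.fst_homeo]
    · refine key _ _ _ ?_
      rw [← hP (0, _), ← hP (1, x)]
      exact congrArg (fun z => j (Subtype.val z)) (α₀.apply_symm_apply (α₁ x))
    · refine key _ _ _ ?_
      rw [← hQ (0, _), ← hQ (1, x)]
      exact congrArg (fun z => j' (Subtype.val z)) (β₀.apply_symm_apply (β₁ x))
  refine ⟨⟨_, hφ⟩, ⟨_, hφ'⟩, α₀.symm.trans β₀, fun φ φ' h h' => ?_⟩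
  have hiso : Isotopic (φ.trans (α₀.symm.trans β₀)) ((α₀.symm.trans β₀).trans φ') := by
    have e1 := (IsTransport.isotopic h hφ).comp (Isotopic.refl (α₀.symm.trans β₀))
    have e2 := ((Isotopic.refl α₀.symm).comp hk).comp (Isotopic.refl β₀)
    have e3 := (Isotopic.refl (α₀.symm.trans β₀)).comp (IsTransport.isotopic hφ' h')
    have i1 : (α₀.symm.trans α₁).trans (α₀.symm.trans β₀) =
        (α₀.symm.trans (α₁.trans α₀.symm)).trans β₀ := rfl
    have i2 : (α₀.symm.trans (β₁.trans β₀.symm)).trans β₀ =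
        (α₀.symm.trans β₀).trans (β₀.symm.trans β₁) := by ext; simp
    rw [i1] at e1
    rw [i2] at e2
    exact (e1.trans e2).trans e3
  refine ⟨hiso, fun A n => ?_⟩
  rw [← cohomologyMap_trans, ← cohomologyMap_trans, hiso.cohomologyMap_eq]

/-! ### Homotopies and circles -/

/-- A family that depends on a parameter in a compact space can be transported along a homotopy, by
cutting the homotopy into short pieces. -/
lemma HasShortTransport.nonempty_fibHomeo {Y B : Type*} [TopologicalSpace Y]
    [NormedAddCommGroup B] {p : Y → B} {C : Set B} (h : HasShortTransport p C) {Z : Type}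
    [PseudoMetricSpace Z] [CompactSpace Z] {F : I × Z → B} (hF : Continuous F)
    (hFC : ∀ q, F q ∈ C) :
    Nonempty (FibHomeo {q : Z × Y | p q.2 = F (0, q.1)} {q : Z × Y | p q.2 = F (1, q.1)}) := by
  obtain ⟨ε, hε, hT⟩ := h
  obtain ⟨δ, hδ, hFδ⟩ := Metric.uniformContinuous_iff.1
    (CompactSpace.uniformContinuous_of_continuous hF) ε hε
  obtain ⟨N, hN⟩ := exists_nat_one_div_lt hδ
  set l : ℕ → I := fun k => Set.projIcc 0 1 zero_le_one ((k : ℝ) / (N + 1)) with hl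
  have hstep : ∀ k : ℕ, dist (l (k + 1)) (l k) < δ := fun k => by
    refine lt_of_le_of_lt ?_ hN
    have h1 := (LipschitzWith.projIcc (a := (0 : ℝ)) (b := 1) zero_le_one).dist_le_mul
      (((k + 1 : ℕ) : ℝ) / (N + 1)) ((k : ℝ) / (N + 1))
    refine h1.trans (le_of_eq ?_)
    rw [NNReal.coe_one, one_mul, Real.dist_eq, ← sub_div]
    push_cast
    rw [add_sub_cancel_left, abs_of_pos (by positivity)]
  have key : ∀ k : ℕ,
      Nonempty (FibHomeo {q : Z × Y | p q.2 = F (l 0, q.1)} {q | p q.2 = F (l k, q.1)}) := by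
    intro k
    induction k with
    | zero => exact ⟨FibHomeo.ofEq rfl⟩
    | succ k ih =>
      obtain ⟨Φ⟩ := ih
      obtain ⟨Ψ⟩ := hT Z (fun z => F (l k, z)) (fun z => F (l (k + 1), z)) (by fun_prop)
        (by fun_prop) (fun z => hFC _) fun z => (hFδ (by
          rw [Prod.dist_eq, dist_self, max_eq_left dist_nonneg]
          exact hstep k)).le
      exact ⟨Φ.trans Ψ⟩
  have h0 : l 0 = 0 := by simp [hl]
  have h1 : l (N + 1) = 1 := by
    exact Set.projIcc_of_right_le _ (by push_cast; rw [div_self (by positivity)])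
  have := key (N + 1)
  rwa [h0, h1] at this

/-- The pullback along a map from a square is trivial: contract the square radially to a
corner. -/
lemma HasShortTransport.nonempty_triv {Y B : Type*} [TopologicalSpace Y]
    [NormedAddCommGroup B] {p : Y → B} {C : Set B} (h : HasShortTransport p C)
    {H : I × I → B} (hH : Continuous H) (hHC : ∀ q, H q ∈ C) :
    Nonempty (Triv {y : Y // p y = H (0, 0)} p H) := by
  obtain ⟨Φ⟩ := h.nonempty_fibHomeo (Z := I × I)
    (F := fun q => H (q.1 * q.2.1, q.1 * q.2.2)) (by fun_prop) fun q => hHC _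
  simp only [zero_mul, one_mul, Prod.mk.eta] at Φ
  let Θ : ((I × I) × {y : Y // p y = H (0, 0)}) ≃ₜ
      {q : (I × I) × Y | p q.2 = H (0, 0)} :=
    { toFun q := ⟨(q.1, q.2.1), q.2.2⟩
      invFun q := (q.1.1, ⟨q.1.2, q.2⟩)
      left_inv _ := rfl
      right_inv _ := rfl
      continuous_toFun := by fun_prop
      continuous_invFun := by fun_prop }
  exact ⟨⟨Θ.trans Φ.homeo, fun q => Φ.fst_homeo _⟩⟩

/-- The circles contained in `W` around the points of the graph of `η` over a disc, given by
the radius and the second coordinate of the centre. -/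
def circlesIn (W : Set (ℂ × ℂ)) (η : ℂ → ℂ) (D : Set ℂ) : Set (ℝ × ℂ) :=
  {q | 0 < q.1 ∧ q.2 ∈ D ∧ Metric.closedBall (η q.2) q.1 ×ˢ {q.2} ⊆ W}

lemma joinedIn_circlesIn_radius {W : Set (ℂ × ℂ)} {η : ℂ → ℂ} {D : Set ℂ} {s : ℂ} {r r' : ℝ}
    (h : (r, s) ∈ circlesIn W η D) (h' : (r', s) ∈ circlesIn W η D) :
    JoinedIn (circlesIn W η D) (r, s) (r', s) := by
  refine JoinedIn.ofLine (f := fun t : ℝ => ((1 - t) * r + t * r', s)) (by fun_prop) (by simp)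
    (by simp) ?_
  rintro _ ⟨t, ⟨ht0, ht1⟩, rfl⟩
  have hr : 0 < r := h.1
  have hr' : 0 < r' := h'.1
  have hmem : ∀ m : ℝ, 0 < m → m ≤ max r r' → (m, s) ∈ circlesIn W η D := fun m hm hle => by
    rcases le_max_iff.1 hle with hle | hle
    · exact ⟨hm, h.2.1, (Set.prod_mono_left (Metric.closedBall_subset_closedBall hle)).trans h.2.2⟩
    · exact ⟨hm, h.2.1, (Set.prod_mono_left
        (Metric.closedBall_subset_closedBall hle)).trans h'.2.2⟩
  refine hmem _ ?_ ?_
  · rcases ht0.eq_or_lt with rfl | ht0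
    · simpa using hr
    · have := mul_nonneg (sub_nonneg.2 ht1) hr.le
      have := mul_pos ht0 hr'
      linarith
  · have h1 := mul_le_mul_of_nonneg_left (le_max_left r r') (sub_nonneg.2 ht1)
    have h2 := mul_le_mul_of_nonneg_left (le_max_right r r') ht0
    linarith

/-- Circles in `W` whose centres lie over the same component are joined through circles in `W`:
shrink the radius, move the centre, and enlarge the radius. -/
lemma joinedIn_circlesIn {W : Set (ℂ × ℂ)} (hW : IsOpen W) {η : ℂ → ℂ} {D : Set ℂ}
    (hD : IsOpen D) (hη : ContinuousOn η D) {o s : ℂ} {r r' : ℝ}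
    (hs : s ∈ connectedComponentIn {s : ℂ | s ∈ D ∧ (η s, s) ∈ W} o)
    (h : (r, o) ∈ circlesIn W η D) (h' : (r', s) ∈ circlesIn W η D) :
    JoinedIn (circlesIn W η D) (r, o) (r', s) := by
  set N : Set ℂ := {s : ℂ | s ∈ D ∧ (η s, s) ∈ W} with hN
  have hNo : IsOpen N := (hη.prodMk continuousOn_id).isOpen_inter_preimage hD hW
  have hoN : o ∈ N := by
    by_contra ho
    rw [connectedComponentIn_eq_empty ho] at hs
    exact hs
  have hconn : IsConnected (connectedComponentIn N o) :=
    isConnected_connectedComponentIn_iff.2 hoN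
  obtain ⟨γ, hγ⟩ := ((hNo.connectedComponentIn.isConnected_iff_isPathConnected.1 hconn).joinedIn
    o (mem_connectedComponentIn hoN) s hs).mono (connectedComponentIn_subset N o)
  have hc : Continuous fun u => (η (γ u), γ u) :=
    (hη.comp_continuous γ.continuous fun u => (hγ u).1).prodMk γ.continuous
  obtain ⟨ε, hε, hεW⟩ := (isCompact_range hc).exists_cthickening_subset_open hW
    (Set.range_subset_iff.2 fun u => (hγ u).2)
  have hmem : ∀ u, (ε, γ u) ∈ circlesIn W η D := by
    refine fun u => ⟨hε, (hγ u).1, fun q hq => hεW ?_⟩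
    refine Metric.mem_cthickening_of_dist_le _ _ _ _ (Set.mem_range_self u) ?_
    obtain ⟨h1, h2⟩ := hq
    rw [Prod.dist_eq, Set.mem_singleton_iff.1 h2, dist_self, max_eq_left dist_nonneg]
    exact h1
  have hmove : JoinedIn (circlesIn W η D) (ε, o) (ε, s) :=
    ⟨γ.map (f := fun z => (ε, z)) (by fun_prop), hmem⟩
  have hεo : (ε, o) ∈ circlesIn W η D := by simpa using hmem 0
  have hεs : (ε, s) ∈ circlesIn W η D := by simpa using hmem 1
  exact ((joinedIn_circlesIn_radius h hεo).trans hmove).trans (joinedIn_circlesIn_radius hεs h')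

lemma circleLoop_apply (c : ℂ) (r : ℝ) (t : I) :
    circleLoop c r t = circleMap c r (2 * Real.pi * t) := rfl

lemma circleLoop_ne {c : ℂ} {r : ℝ} (hr : 0 < r) (t : I) : circleLoop c r t ≠ c :=
  circleMap_ne_center hr.ne'

lemma circleLoop_mem_closedBall {c : ℂ} {r : ℝ} (hr : 0 < r) (t : I) :
    circleLoop c r t ∈ Metric.closedBall c r :=
  circleMap_mem_closedBall c hr.le _

/-- A map that is proper over `S` has compact preimages of compact subsets of `S`. -/
lemma isCompact_preimage_of_restrictPreimage {Y B : Type*} [TopologicalSpace Y]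
    [TopologicalSpace B] {f : Y → B} {S D : Set B} (hf : IsProperMap (S.restrictPreimage f))
    (hDS : D ⊆ S) (hD : IsCompact D) : IsCompact (f ⁻¹' D) := by
  have h1 : IsCompact (Subtype.val ⁻¹' D : Set S) := by
    rw [Subtype.isCompact_iff, Subtype.image_preimage_coe, Set.inter_eq_right.2 hDS]
    exact hD
  have h2 := (hf.isCompact_preimage h1).image continuous_subtype_val
  convert! h2
  ext y
  constructor
  · exact fun hy => ⟨⟨y, hDS hy⟩, hy, rfl⟩
  · rintro ⟨y, hy, rfl⟩
    exact hy

end Isomonodromy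

theorem mainTheorem3
    {E : Type*} [NormedAddCommGroup E] [NormedSpace ℂ E] [FiniteDimensional ℂ E]
    {X Y : Type u} [TopologicalSpace X]
    [TopologicalSpace Y] [T2Space Y] [SecondCountableTopology Y]
    [ChartedSpace E Y] [IsManifold 𝓘(ℂ, E) ω Y]
    (g : X → ℂ) (G : Y → ℂ × ℂ) (o : ℂ) (R : ℝ) (hR : 0 < R)
    (hG : ContMDiff 𝓘(ℂ, E) 𝓘(ℂ, ℂ × ℂ) ω G)
    (hdef : Isomonodromy.IsDeformation g G o R)
    (hproper : IsProperMap (Set.restrictPreimage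
      ((Set.univ ×ˢ Metric.ball o R) \ Isomonodromy.discriminant (E := E) G) G))
    (η : ℂ → ℂ) (hη : ContDiffOn ℝ ∞ η (Metric.ball o R)) (hη0 : η o = 0)
    (W : Set (ℂ × ℂ)) (hW : IsOpen W) (hW0 : ((0 : ℂ), o) ∈ W)
    (hdisc : Isomonodromy.discriminant (E := E) G ∩ W = Isomonodromy.graphOver η o R ∩ W) :
    ∀ s ∈ connectedComponentIn {s : ℂ | s ∈ Metric.ball o R ∧ (η s, s) ∈ W} o,
      ∀ r₀ > 0, Metric.closedBall (0 : ℂ) r₀ ×ˢ {o} ⊆ W →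
      ∀ r > 0, Metric.closedBall (η s) r ×ˢ {s} ⊆ W →
        Isomonodromy.ConjugateMonodromy g 0 r₀ (Isomonodromy.member G s) (η s) r := by
  open Isomonodromy in
  intro s hs r₀ hr₀ hW₀ r hr hWs
  obtain ⟨e, he⟩ := hdef.2
  have hηc : ContinuousOn η (Metric.ball o R) := hη.continuousOn
  have hsR : s ∈ Metric.ball o R := (connectedComponentIn_subset _ _ hs).1
  -- the part of `W` over the disc and off the graph consists of regular values of `G`
  set O : Set (ℂ × ℂ) := W ∩ ((Set.univ ×ˢ Metric.ball o R) ∩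
    (fun q => q.1 - η q.2) ⁻¹' {0}ᶜ) with hO
  have hOo : IsOpen O := by
    refine hW.inter (ContinuousOn.isOpen_inter_preimage ?_ (isOpen_univ.prod Metric.isOpen_ball)
      isOpen_compl_singleton)
    exact continuousOn_fst.sub (hηc.comp continuousOn_snd fun q hq => hq.2)
  have hOd : ∀ q ∈ O, q ∉ discriminant (E := E) G := fun q hq hqd => by
    have h1 : q ∈ graphOver η o R ∩ W := hdisc ▸ ⟨hqd, hq.1⟩
    exact hq.2.2 (sub_eq_zero.2 h1.1.2)
  -- the free homotopy of circles
  obtain ⟨γ, hγ⟩ := joinedIn_circlesIn hW Metric.isOpen_ball hηc hs (r := r₀) (r' := r)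
    ⟨hr₀, Metric.mem_ball_self hR, by rw [hη0]; exact hW₀⟩ ⟨hr, hsR, hWs⟩
  let H : I × I → ℂ × ℂ := fun q =>
    (circleLoop (η (γ q.1).2) (γ q.1).1 q.2, (γ q.1).2)
  have hηγ : Continuous fun u => η (γ u).2 :=
    hηc.comp_continuous (by fun_prop) fun u => (hγ u).2.1
  have hH : Continuous H := by
    change Continuous fun q : I × I => (η (γ q.1).2 + ((γ q.1).1 : ℂ) *
      Complex.exp ((2 * Real.pi * (q.2 : ℝ) : ℝ) * Complex.I), (γ q.1).2)
    have := hηγ.comp (continuous_fst (X := I) (Y := I))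
    exact (this.add (by fun_prop)).prodMk (by fun_prop)
  have hHO : ∀ q, H q ∈ O := fun q =>
    ⟨(hγ q.1).2.2 ⟨circleLoop_mem_closedBall (hγ q.1).1 _, rfl⟩,
      ⟨Set.mem_univ _, (hγ q.1).2.1⟩, fun h => circleLoop_ne (hγ q.1).1 q.2 (sub_eq_zero.1 h)⟩
  have hshort : HasShortTransport G (Set.range H) := by
    refine hasShortTransport_of_compact hG (isCompact_range hH) hOo
      (Set.range_subset_iff.2 hHO) (fun y hy => ?_) fun D hDO hD =>
      isCompact_preimage_of_restrictPreimage hproper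
        (fun q hq => ⟨(hDO hq).2.1, hOd q (hDO hq)⟩) hD
    by_contra h
    exact hOd _ hy ⟨y, h, rfl⟩
  obtain ⟨T⟩ := hshort.nonempty_triv hH Set.mem_range_self
  have hj : IsSlice g G o (fun x => (e x).1) :=
    ⟨Topology.IsEmbedding.subtypeVal.comp e.isEmbedding,
      fun x => Prod.ext (he x) (e x).2, fun y hy => ⟨e.symm ⟨y, hy⟩, by simp⟩⟩
  have hj' : IsSlice (member G s) G s Subtype.val :=
    ⟨Topology.IsEmbedding.subtypeVal, fun x => Prod.ext rfl x.2, fun y hy => ⟨⟨y, hy⟩, rfl⟩⟩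
  refine conjugateMonodromy_of_triv hj hj' T (fun t => ?_) (fun t => ?_) fun u => ?_
  · simp [H, circleLoop_apply, hη0]
  · simp [H, circleLoop_apply]
  · simp [H]
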